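/- Let $d\ge 1$ be an integer. For $f:\mathbb{R}^d\to\mathbb{R}$ let $G(f)=\{(x,f(x)):x\in\mathbb{R}^d\}\subseteq\mathbb{R}^{d+1}$ denote its graph, with the subspace topology, and call $f$ additive if $f(x+y)=f(x)+f(y)$ for all $x,y\in\mathbb{R}^d$. (a) If $f:\mathbb{R}^d\to\mathbb{R}$ is additive, then there exists $s\in\{0,1,\dots,d+1\}$ such that the connected component $G$ of $G(f)$ which contains the origin is a dense subgroup of an $s$-dimensional vector subspace of $\mathbb{R}^{d+1}$. Furthermore, every connected component of $G(f)$ is a translate $\tau+G$ of $G$, with $\tau\in\mathbb{R}^{d+1}$. (b) All cases described in (a) occur: for every $s\in\{0,1,\dots,d+1\}$ there is an additive function $f:\mathbb{R}^d\to\mathbb{R}$, of the form $f(x_1,\dots,x_d)=A_1(x_1)+\dots+A_d(x_d)$ with every $A_k:\mathbb{R}\to\mathbb{R}$ additive, such that the connected component of $G(f)$ which contains the origin is a dense subgroup of an $s$-dimensional vector subspace of $\mathbb{R}^{d+1}$. -/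

import Mathlib

/-- `f` is additive: it solves Cauchy's functional equation. -/
def IsAdditiveFun {M : Type*} [Add M] (f : M → ℝ) : Prop :=
  ∀ x y, f (x + y) = f x + f y

/-- The graph `G(f) = {(x, f x) : x ∈ ℝ^d}`, as a subset of `ℝ^(d+1) = ℝ^d × ℝ`. -/
def funGraph {d : ℕ} (f : (Fin d → ℝ) → ℝ) : Set ((Fin d → ℝ) × ℝ) :=
  {p | ∃ x, p = (x, f x)}

/-- The connected component of `G(f)` (with the subspace topology) that contains the origin.
If `f` is additive then the origin does lie on the graph. -/
def zeroComponent {d : ℕ} (f : (Fin d → ℝ) → ℝ) : Set ((Fin d → ℝ) × ℝ) :=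
  connectedComponentIn (funGraph f) 0

/-- `C` is a connected component of `G(f)` (with the subspace topology). -/
def IsGraphComponent {d : ℕ} (f : (Fin d → ℝ) → ℝ) (C : Set ((Fin d → ℝ) × ℝ)) : Prop :=
  ∃ p ∈ funGraph f, C = connectedComponentIn (funGraph f) p

/-- The set `C` is a dense (additive) subgroup of some `s`-dimensional vector subspace `V` of
`ℝ^(d+1) = ℝ^d × ℝ`. -/
def IsDenseSubgroupOfDim {d : ℕ} (C : Set ((Fin d → ℝ) × ℝ)) (s : ℕ) : Prop :=
  ∃ V : Submodule ℝ ((Fin d → ℝ) × ℝ), Module.finrank ℝ V = s ∧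
    ∃ H : AddSubgroup ((Fin d → ℝ) × ℝ), (H : Set ((Fin d → ℝ) × ℝ)) = C ∧
      C ⊆ (V : Set ((Fin d → ℝ) × ℝ)) ∧ (V : Set ((Fin d → ℝ) × ℝ)) ⊆ closure C

/-! ### Closed connected subgroups are subspaces -/

open Set Filter Topology

/-! (a) Translation by a point of the graph is a homeomorphism preserving the graph, so components
are translates of one subgroup. Its closure is a closed connected subgroup, hence a linear subspace:
modulo the lines it contains, a closed subgroup is discrete
(`AddSubgroup.exists_submodule_eq_of_isClosed`).

(b) For `s ≤ d`, take values in a countable set that determine rational functionals of the last `d -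
s` coordinates; connectedness then forces these coordinates to vanish. For `s = d + 1`, build `g` on
`ℝ` whose graph meets every closed planar set projecting onto an interval
(`exists_additive_meets_isClosed`). That graph is dense and connected, and `x ↦ g (x 0)` inherits
both properties. -/

/-- The linear subspace of all `v` whose line `ℝ v` is contained in the additive subgroup `K`. -/
def AddSubgroup.lineSpace {E : Type*} [AddCommGroup E] [Module ℝ E] (K : AddSubgroup E) :
    Submodule ℝ E where
  carrier := {v | ∀ t : ℝ, t • v ∈ K}
  add_mem' {a b} ha hb t := by
    rw [smul_add]
    exact K.add_mem (ha t) (hb t)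
  zero_mem' t := by simp
  smul_mem' c v hv t := by
    rw [smul_smul]
    exact hv _

theorem AddSubgroup.mem_of_mem_lineSpace {E : Type*} [AddCommGroup E] [Module ℝ E] {K : AddSubgroup E}
    {v : E} (hv : v ∈ K.lineSpace) : v ∈ K := by
  simpa using hv 1

/-- A limit of directions of elements of a closed subgroup tending to zero spans a line in it. -/
theorem AddSubgroup.mem_lineSpace_of_tendsto {E : Type*} [NormedAddCommGroup E] [NormedSpace ℝ E]
    {K : AddSubgroup E} (hK : IsClosed (K : Set E)) {x : ℕ → E} {u : E}
    (hx : ∀ n, x n ∈ K) (h0 : ∀ n, x n ≠ 0) (hlim : Tendsto (fun n => ‖x n‖) atTop (𝓝 0))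
    (hu : Tendsto (fun n => ‖x n‖⁻¹ • x n) atTop (𝓝 u)) : u ∈ K.lineSpace := by
  intro t
  have hround : Tendsto (fun n => (⌊t / ‖x n‖⌋ : ℝ) * ‖x n‖) atTop (𝓝 t) := by
    have h1 : Tendsto (fun n => t - ‖x n‖) atTop (𝓝 t) := by
      simpa using tendsto_const_nhds.sub hlim
    refine tendsto_of_tendsto_of_tendsto_of_le_of_le h1 tendsto_const_nhds (fun n => ?_)
      (fun n => ?_)
    · have hp : 0 < ‖x n‖ := norm_pos_iff.2 (h0 n)
      have := Int.lt_floor_add_one (t / ‖x n‖)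
      rw [div_lt_iff₀ hp] at this
      dsimp only
      linarith
    · have hp : 0 < ‖x n‖ := norm_pos_iff.2 (h0 n)
      have := Int.floor_le (t / ‖x n‖)
      rwa [le_div_iff₀ hp] at this
  refine hK.mem_of_tendsto (hround.smul hu) (Eventually.of_forall fun n => ?_)
  have hp : ‖x n‖ ≠ 0 := norm_ne_zero_iff.2 (h0 n)
  rw [smul_smul, mul_assoc, mul_inv_cancel₀ hp, mul_one, Int.cast_smul_eq_zsmul]
  exact K.zsmul_mem (hx n) _

/-- A closed subgroup is discrete in every closed subspace that contains none of its lines. -/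
theorem AddSubgroup.exists_pos_le_norm_of_disjoint {E : Type*} [NormedAddCommGroup E]
    [NormedSpace ℝ E] [FiniteDimensional ℝ E] {K : AddSubgroup E} (hK : IsClosed (K : Set E))
    {W : Submodule ℝ E} (hW : Disjoint K.lineSpace W) :
    ∃ ε > 0, ∀ x ∈ K, x ∈ W → x ≠ 0 → ε ≤ ‖x‖ := by
  by_contra! h
  choose x hxK hxW hx0 hxn using fun n : ℕ => h (1 / ((n : ℝ) + 1)) (by positivity)
  have hlim : Tendsto (fun n => ‖x n‖) atTop (𝓝 0) :=
    squeeze_zero (fun _ => norm_nonneg _) (fun n => (hxn n).le)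
      tendsto_one_div_add_atTop_nhds_zero_nat
  have hs : ∀ n, ‖x n‖⁻¹ • x n ∈ Metric.sphere (0 : E) 1 := fun n => by
    simp [norm_smul, hx0 n]
  obtain ⟨u, hu, φ, hφ, hφu⟩ := (isCompact_sphere (0 : E) 1).tendsto_subseq hs
  have h1 : u ∈ K.lineSpace :=
    AddSubgroup.mem_lineSpace_of_tendsto hK (fun n => hxK (φ n)) (fun n => hx0 (φ n))
      (hlim.comp hφ.tendsto_atTop) hφu
  have h2 : u ∈ W := W.closed_of_finiteDimensional.mem_of_tendsto hφu
    (Eventually.of_forall fun n => W.smul_mem _ (hxW _))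
  have h3 : u = 0 := Submodule.disjoint_def.1 hW u h1 h2
  simp [h3] at hu

/-- A closed connected subgroup of a finite-dimensional space is a linear subspace. -/
theorem AddSubgroup.exists_submodule_eq_of_isClosed {E : Type*} [NormedAddCommGroup E]
    [NormedSpace ℝ E] [FiniteDimensional ℝ E] {K : AddSubgroup E} (hK : IsClosed (K : Set E))
    (hc : IsPreconnected (K : Set E)) : ∃ V : Submodule ℝ E, (V : Set E) = K := by
  obtain ⟨W, hW⟩ := K.lineSpace.exists_isCompl
  obtain ⟨ε, hε, hmin⟩ := AddSubgroup.exists_pos_le_norm_of_disjoint hK hW.disjoint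
  -- Projection onto `W` along the line space; it maps `K` into the discrete part `K ∩ W`.
  let π : E →ₗ[ℝ] E := W.subtype ∘ₗ W.projectionOnto _ hW.symm
  have hπW : ∀ x, π x ∈ W := fun x => (W.projectionOnto _ hW.symm x).2
  have hπV : ∀ x, x - π x ∈ K.lineSpace := fun x => by
    rw [← Submodule.projectionOnto_apply_eq_zero_iff hW.symm, map_sub, sub_eq_zero]
    exact (Submodule.projectionOnto_apply_left hW.symm _).symm
  have hπK : ∀ x ∈ K, π x ∈ K := fun x hx => by
    simpa using K.sub_mem hx (AddSubgroup.mem_of_mem_lineSpace (hπV x))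
  have hπ0 : ∀ x ∈ K, π x = 0 := by
    intro x hx
    by_contra hne
    have hcont : Continuous fun y => ‖π y‖ := (LinearMap.continuous_of_finiteDimensional π).norm
    have hle := hmin _ (hπK x hx) (hπW x) hne
    -- By connectedness `‖π y‖` would take the value `ε / 2` on `K`, inside the gap `(0, ε)`.
    have := (hc.image _ hcont.continuousOn).Icc_subset (mem_image_of_mem _ K.zero_mem)
      (mem_image_of_mem _ hx)
    obtain ⟨y, hy, hyn⟩ := this (show ε / 2 ∈ _ from ⟨by simp; linarith, by linarith⟩)
    dsimp only at hyn
    have hy0 : π y ≠ 0 := fun h => by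
      rw [h, norm_zero] at hyn
      linarith
    have := hmin _ (hπK y hy) (hπW y) hy0
    linarith
  refine ⟨K.lineSpace, Subset.antisymm (fun x hx => AddSubgroup.mem_of_mem_lineSpace hx) fun x hx => ?_⟩
  simpa [hπ0 x hx] using hπV x

/-! ### Components of the graph as cosets -/

section Components

variable {d : ℕ} {f : (Fin d → ℝ) → ℝ}

theorem IsAdditiveFun.map_zero' {M : Type*} [AddMonoid M] {f : M → ℝ} (hf : IsAdditiveFun f) :
    f 0 = 0 := by
  simpa using hf 0 0

theorem IsAdditiveFun.map_neg' {M : Type*} [AddGroup M] {f : M → ℝ} (hf : IsAdditiveFun f)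
    (x : M) : f (-x) = -f x := by
  have := hf x (-x)
  rw [add_neg_cancel, hf.map_zero'] at this
  linarith

theorem mem_funGraph {p : (Fin d → ℝ) × ℝ} : p ∈ funGraph f ↔ f p.1 = p.2 := by
  constructor
  · rintro ⟨x, rfl⟩
    rfl
  · intro h
    exact ⟨p.1, by rw [h]⟩

theorem zero_mem_funGraph (hf : IsAdditiveFun f) : 0 ∈ funGraph f :=
  mem_funGraph.2 hf.map_zero'

theorem add_mem_funGraph (hf : IsAdditiveFun f) {p q : (Fin d → ℝ) × ℝ} (hp : p ∈ funGraph f)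
    (hq : q ∈ funGraph f) : p + q ∈ funGraph f := by
  rw [mem_funGraph] at *
  rw [Prod.fst_add, Prod.snd_add, hf, hp, hq]

theorem neg_mem_funGraph (hf : IsAdditiveFun f) {p : (Fin d → ℝ) × ℝ} (hp : p ∈ funGraph f) :
    -p ∈ funGraph f := by
  rw [mem_funGraph] at *
  rw [Prod.fst_neg, Prod.snd_neg, hf.map_neg', hp]

theorem image_add_left_funGraph (hf : IsAdditiveFun f) {p : (Fin d → ℝ) × ℝ}
    (hp : p ∈ funGraph f) : (fun q => p + q) '' funGraph f = funGraph f := by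
  refine Subset.antisymm ?_ fun q hq => ?_
  · rintro _ ⟨q, hq, rfl⟩
    exact add_mem_funGraph hf hp hq
  · exact ⟨-p + q, add_mem_funGraph hf (neg_mem_funGraph hf hp) hq, by simp⟩

theorem connectedComponentIn_funGraph (hf : IsAdditiveFun f) {p : (Fin d → ℝ) × ℝ}
    (hp : p ∈ funGraph f) :
    connectedComponentIn (funGraph f) p = (fun q => p + q) '' zeroComponent f := by
  have := (Homeomorph.addLeft p).image_connectedComponentIn (zero_mem_funGraph hf)
  rw [zeroComponent]
  simp only [Homeomorph.coe_addLeft, add_zero] at this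
  rw [this, image_add_left_funGraph hf hp]

/-- The connected component of the origin in the graph of an additive function. -/
def zeroComponentSubgroup (hf : IsAdditiveFun f) : AddSubgroup ((Fin d → ℝ) × ℝ) where
  carrier := zeroComponent f
  zero_mem' := mem_connectedComponentIn (zero_mem_funGraph hf)
  add_mem' {a b} ha hb := by
    rw [zeroComponent, connectedComponentIn_eq ha,
      connectedComponentIn_funGraph hf (connectedComponentIn_subset _ _ ha)]
    exact ⟨b, hb, rfl⟩
  neg_mem' {a} ha := by
    have ha' := ha
    rw [zeroComponent, connectedComponentIn_eq ha,
      connectedComponentIn_funGraph hf (connectedComponentIn_subset _ _ ha)] at ha'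
    have h0 : (0 : (Fin d → ℝ) × ℝ) ∈ zeroComponent f :=
      mem_connectedComponentIn (zero_mem_funGraph hf)
    rw [zeroComponent, connectedComponentIn_eq ha,
      connectedComponentIn_funGraph hf (connectedComponentIn_subset _ _ ha)] at h0
    obtain ⟨q, hq, hq0⟩ := h0
    rwa [neg_eq_of_add_eq_zero_right hq0]

theorem exists_isDenseSubgroupOfDim_zeroComponent (hf : IsAdditiveFun f) :
    ∃ s : ℕ, s ≤ d + 1 ∧ IsDenseSubgroupOfDim (zeroComponent f) s := by
  obtain ⟨V, hV⟩ := AddSubgroup.exists_submodule_eq_of_isClosed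
    (K := (zeroComponentSubgroup hf).topologicalClosure)
    (AddSubgroup.isClosed_topologicalClosure _) isPreconnected_connectedComponentIn.closure
  have hV' : (V : Set ((Fin d → ℝ) × ℝ)) = closure (zeroComponent f) := hV
  refine ⟨Module.finrank ℝ V, ?_, V, rfl, zeroComponentSubgroup hf, rfl, ?_, hV'.le⟩
  · simpa using V.finrank_le
  · rw [hV']
    exact subset_closure

theorem exists_rat_linearMap_ne_zero : ∃ g : ℝ →ₗ[ℚ] ℚ, g ≠ 0 := by
  obtain ⟨g, hg⟩ := Module.Projective.exists_dual_eq_one ℚ (one_ne_zero (α := ℝ))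
  exact ⟨g, fun h => by simp [h] at hg⟩

end Components

/-! ### Transfinite choice of a Hamel-type family -/

section Selection

open Cardinal

/-- A nontrivial relation could be solved for its term of largest index. -/
theorem linearIndependent_of_notMem_span_image_Iio {ι K V : Type*} [LinearOrder ι] [DivisionRing K]
    [AddCommGroup V] [Module K V] {x : ι → V}
    (h : ∀ i, x i ∉ Submodule.span K (x '' Iio i)) : LinearIndependent K x := by
  rw [linearIndependent_iff]
  intro l hl
  by_contra hne
  have hs : l.support.Nonempty := Finsupp.support_nonempty_iff.2 hne
  set i := l.support.max' hs with hi
  have him : i ∈ l.support := l.support.max'_mem hs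
  rw [Finsupp.linearCombination_apply, Finsupp.sum, ← Finset.add_sum_erase _ _ him,
    add_eq_zero_iff_eq_neg] at hl
  refine h i ?_
  have hmem : l i • x i ∈ Submodule.span K (x '' Iio i) := by
    rw [hl]
    refine Submodule.neg_mem _ (Submodule.sum_mem _ fun j hj => Submodule.smul_mem _ _ ?_)
    refine Submodule.subset_span ⟨j, ?_, rfl⟩
    exact lt_of_le_of_ne (l.support.le_max' j (Finset.mem_of_mem_erase hj))
      (Finset.ne_of_mem_erase hj)
  exact (Submodule.smul_mem_iff _ (Finsupp.mem_support_iff.1 him)).1 hmem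

theorem mk_span_rat_lt_continuum {s : Set ℝ} (hs : #s < 𝔠) :
    #(Submodule.span ℚ s) < 𝔠 := by
  have h1 : #(Submodule.span ℚ s) ≤ #(s →₀ ℚ) := by
    have : Submodule.span ℚ s = LinearMap.range (Finsupp.linearCombination ℚ ((↑) : s → ℝ)) := by
      rw [Finsupp.range_linearCombination, Subtype.range_coe]
    rw [this]
    exact mk_range_le
  refine h1.trans_lt ?_
  rcases isEmpty_or_nonempty s with he | hn
  · simpa using one_lt_aleph0.trans aleph0_lt_continuum
  · rw [mk_finsupp_of_infinite', Cardinal.mkRat]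
    exact max_lt hs aleph0_lt_continuum

/-- Continuum many sets of reals of size continuum have a `ℚ`-linearly independent selector. -/
theorem exists_linearIndependent_rat_selector {ι : Type} (hι : #ι ≤ 𝔠) (S : ι → Set ℝ)
    (hS : ∀ i, 𝔠 ≤ #(S i)) : ∃ x : ι → ℝ, LinearIndependent ℚ x ∧ ∀ i, x i ∈ S i := by
  -- A well-order of minimal type, so that every proper initial segment has fewer than `𝔠` elements.
  obtain ⟨_, _, hord⟩ := exists_ord_eq_type_lt ι
  have key : ∀ (i : ι) (x : Iio i → ℝ), ∃ y ∈ S i, y ∉ Submodule.span ℚ (range x) := by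
    intro i x
    by_contra! hsub
    have h1 : #(range x) < 𝔠 := mk_range_le.trans_lt ((mk_Iio_lt i hord).trans_le hι)
    exact ((hS i).trans (mk_le_mk_of_subset hsub)).not_gt (mk_span_rat_lt_continuum h1)
  choose next hnext hnot using key
  let x : ι → ℝ := wellFounded_lt.fix fun i rec => next i fun j => rec j.1 j.2
  have hx : ∀ i, x i = next i fun j => x j.1 := fun i => wellFounded_lt.fix_eq _ i
  refine ⟨x, linearIndependent_of_notMem_span_image_Iio fun i => ?_, fun i => ?_⟩
  · have := hnot i fun j => x j.1
    rwa [← hx, show range (fun j : Iio i => x j.1) = x '' Iio i by rw [image_eq_range]] at this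
  · rw [hx]
    exact hnext _ _

/-- There is an additive function whose graph meets every closed subset of the plane that projects
onto a nondegenerate interval. -/
theorem exists_additive_meets_isClosed : ∃ g : ℝ → ℝ, IsAdditiveFun g ∧
    ∀ K : Set (ℝ × ℝ), IsClosed K → ∀ a b : ℝ, a < b → Ioo a b ⊆ Prod.fst '' K →
      ∃ x, (x, g x) ∈ K := by
  let ι := {K : Set (ℝ × ℝ) // IsClosed K ∧ ∃ a b : ℝ, a < b ∧ Ioo a b ⊆ Prod.fst '' K}
  have hι : #ι ≤ 𝔠 := by
    -- Closed sets are Borel, and a second-countable space has at most `𝔠` Borel sets.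
    have h1 : #ι ≤ #{K : Set (ℝ × ℝ) // MeasurableSet K} :=
      mk_le_mk_of_subset (s := {K | IsClosed K ∧ ∃ a b : ℝ, a < b ∧ Ioo a b ⊆ Prod.fst '' K})
        (t := {K | MeasurableSet K}) fun K hK => hK.1.measurableSet
    refine h1.trans ?_
    have := MeasurableSpace.cardinal_measurableSet_le_continuum
      ((TopologicalSpace.countable_countableBasis (ℝ × ℝ)).le_aleph0.trans aleph0_le_continuum)
    rwa [← (TopologicalSpace.isBasis_countableBasis (ℝ × ℝ)).borel_eq_generateFrom,
      ← BorelSpace.measurable_eq] at this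
  obtain ⟨x, hx, hxS⟩ := exists_linearIndependent_rat_selector hι (fun K => Prod.fst '' K.1)
    fun K => by
      obtain ⟨a, b, hab, hsub⟩ := K.2.2
      rw [← mk_Ioo_real hab]
      exact mk_le_mk_of_subset hsub
  choose p hp hpx using hxS
  obtain ⟨g, hg⟩ : ∃ g : ℝ →ₗ[ℚ] ℝ, ∀ i, g (x i) = (p i).2 := by
    obtain ⟨g, hg⟩ := LinearMap.exists_extend
      ((Module.Basis.span hx).constr ℚ fun i => (p i).2)
    refine ⟨g, fun i => ?_⟩
    have h2 := LinearMap.congr_fun hg (Module.Basis.span hx i)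
    rwa [LinearMap.comp_apply, Module.Basis.constr_basis, Submodule.subtype_apply,
      Module.Basis.span_apply] at h2
  refine ⟨g, map_add g, fun K hK a b hab hsub => ?_⟩
  let i : ι := ⟨K, hK, a, b, hab, hsub⟩
  refine ⟨x i, ?_⟩
  rw [hg, ← hpx i]
  exact hp i

end Selection

/-! ### Density and connectedness of the planar graph -/

section Graph

variable {g : ℝ → ℝ}

theorem dense_range_graph_of_meets_isClosed
    (h : ∀ K : Set (ℝ × ℝ), IsClosed K → ∀ a b : ℝ, a < b → Ioo a b ⊆ Prod.fst '' K →
      ∃ x, (x, g x) ∈ K) : Dense (range fun x => (x, g x)) := by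
  intro p
  rw [Metric.mem_closure_range_iff]
  intro ε hε
  obtain ⟨x, hx⟩ := h (Metric.closedBall p (ε / 2)) Metric.isClosed_closedBall (p.1 - ε / 2)
    (p.1 + ε / 2) (by linarith) fun x hx => ⟨(x, p.2), by
      rw [← Real.ball_eq_Ioo, Metric.mem_ball] at hx
      simpa [Prod.dist_eq, hε.le] using hx.le, rfl⟩
  rw [Metric.mem_closedBall, dist_comm] at hx
  exact ⟨x, by linarith⟩

/-- If almost all vertical lines lie in one of the disjoint open sets `u`, `v` covering the graph
of `g`, then the part of the graph in `u` lies over an open set. -/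
theorem isOpen_setOf_graph_mem {u v : Set (ℝ × ℝ)} (hu : IsOpen u) (hv : IsOpen v)
    (huv : Disjoint u v) (hcov : ∀ x, (x, g x) ∈ u ∪ v)
    (hD : Dense {x : ℝ | ∀ y : ℝ, (x, y) ∈ u ∪ v}) : IsOpen {x | (x, g x) ∈ u} := by
  have hline : ∀ {u v : Set (ℝ × ℝ)}, IsOpen u → IsOpen v → Disjoint u v → ∀ {x : ℝ},
      (∀ y, (x, y) ∈ u ∪ v) → ∀ {y}, (x, y) ∈ u → ∀ z, (x, z) ∈ u := by
    intro u v hu hv huv x hx y hy z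
    have hpre : IsPreconnected (range fun y : ℝ => (x, y)) :=
      isPreconnected_range (by fun_prop)
    have := hpre.subset_left_of_subset_union hu hv huv (range_subset_iff.2 hx)
      ⟨(x, y), mem_range_self y, hy⟩
    exact this (mem_range_self z)
  have hoff : ∀ {p}, p ∈ u → p ∉ v := fun hp hq => disjoint_left.1 huv hp hq
  rw [isOpen_iff_mem_nhds]
  intro x hx
  have hN : IsOpen {t : ℝ | (t, g x) ∈ u} := hu.preimage (by fun_prop)
  filter_upwards [hN.mem_nhds hx] with t ht
  refine (hcov t).resolve_right fun htv => ?_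
  have hN' : IsOpen {r : ℝ | (r, g t) ∈ v} := hv.preimage (by fun_prop)
  -- The vertical line over `r` would lie wholly in `u`, yet it meets `v` at height `g t`.
  obtain ⟨r, ⟨hr1, hr2⟩, hrD⟩ := hD.inter_open_nonempty _ (hN.inter hN') ⟨t, ht, htv⟩
  exact hoff (hline hu hv huv hrD hr1 (g t)) hr2

theorem isPreconnected_range_graph_of_meets_isClosed
    (h : ∀ K : Set (ℝ × ℝ), IsClosed K → ∀ a b : ℝ, a < b → Ioo a b ⊆ Prod.fst '' K →
      ∃ x, (x, g x) ∈ K) : IsPreconnected (range fun x => (x, g x)) := by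
  rintro u v hu hv hcov ⟨_, ⟨x, rfl⟩, hxu⟩ ⟨_, ⟨y, rfl⟩, hyv⟩
  by_contra hemp
  have huv : Disjoint u v := by
    rw [disjoint_iff_inter_eq_empty, ← not_nonempty_iff_eq_empty]
    intro hne
    obtain ⟨p, hp, hpg⟩ :=
      (dense_range_graph_of_meets_isClosed h).inter_open_nonempty _ (hu.inter hv) hne
    exact hemp ⟨p, hpg, hp⟩
  have hcov' : ∀ x, (x, g x) ∈ u ∪ v := fun x => hcov (mem_range_self x)
  have hD : Dense {x : ℝ | ∀ y : ℝ, (x, y) ∈ u ∪ v} := by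
    refine dense_of_exists_between fun {a b} hab => ?_
    by_contra! hno
    -- If every line over `(a, b)` left `u ∪ v`, this closed complement would project onto `(a, b)`
    -- and so meet the graph.
    obtain ⟨t, ht⟩ := h (u ∪ v)ᶜ (hu.union hv).isClosed_compl a b hab fun t ht => by
      by_contra hmem
      refine hno t (fun y => ?_) ht
      by_contra hy
      exact hmem ⟨(t, y), hy, rfl⟩
    exact ht (hcov' t)
  have hA := isOpen_setOf_graph_mem hu hv huv hcov' hD
  have hB := isOpen_setOf_graph_mem hv hu huv.symm (fun x => (hcov' x).symm)
    (by simpa only [union_comm] using hD)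
  obtain ⟨t, -, ht1, ht2⟩ := isPreconnected_univ _ _ hA hB (fun t _ => hcov' t)
    ⟨x, mem_univ _, hxu⟩ ⟨y, mem_univ _, hyv⟩
  exact disjoint_left.1 huv ht1 ht2

end Graph

/-! ### Realising every dimension -/

theorem IsAdditiveFun.sum_coord {d : ℕ} {A : Fin d → ℝ → ℝ} (hA : ∀ k, IsAdditiveFun (A k)) :
    IsAdditiveFun fun x : Fin d → ℝ => ∑ k, A k (x k) := fun x y => by
  simp only [Pi.add_apply, hA _ _ _, Finset.sum_add_distrib]

/-- There is an additive function on `ℝ^d`, `d ≥ 1`, whose graph is connected and dense. -/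
theorem exists_zeroComponent_dense {d : ℕ} (hd : 1 ≤ d) :
    ∃ f : (Fin d → ℝ) → ℝ, IsAdditiveFun f ∧
      (∃ A : Fin d → ℝ → ℝ, (∀ k, IsAdditiveFun (A k)) ∧ ∀ x, f x = ∑ k, A k (x k)) ∧
      IsDenseSubgroupOfDim (zeroComponent f) (d + 1) := by
  obtain ⟨g, hg, hmeet⟩ := exists_additive_meets_isClosed
  let i : Fin d := ⟨0, hd⟩
  let A : Fin d → ℝ → ℝ := fun k => if k = i then g else 0
  have hA : ∀ k, IsAdditiveFun (A k) := by
    intro k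
    by_cases hk : k = i
    · simpa only [A, hk, if_true] using hg
    · intro x y
      simp [A, hk]
  have hf := IsAdditiveFun.sum_coord hA
  have hfg : ∀ x : Fin d → ℝ, ∑ k, A k (x k) = g (x i) := fun x => by
    rw [Finset.sum_eq_single i (fun k _ hk => by simp [A, hk]) (by simp)]
    simp [A]
  refine ⟨_, hf, ⟨A, hA, fun _ => rfl⟩, ?_⟩
  set f : (Fin d → ℝ) → ℝ := fun x => ∑ k, A k (x k)
  -- Coordinate `i` of the second factor is overwritten; the redundancy makes the graph of `f` an
  -- image of a product.
  let Φ : (ℝ × ℝ) × (Fin d → ℝ) → (Fin d → ℝ) × ℝ := fun q => (Function.update q.2 i q.1.1, q.1.2)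
  have hΦ : Continuous Φ := by
    refine Continuous.prodMk (Continuous.update continuous_snd i ?_) ?_ <;> fun_prop
  have himage : funGraph f = Φ '' ((range fun x => (x, g x)) ×ˢ univ) := by
    ext p
    rw [mem_funGraph, show f p.1 = g (p.1 i) from hfg p.1]
    constructor
    · intro hp
      exact ⟨((p.1 i, p.2), p.1), ⟨⟨p.1 i, Prod.ext rfl hp⟩, mem_univ _⟩, by simp [Φ]⟩
    · rintro ⟨⟨_, y⟩, ⟨⟨x, rfl⟩, -⟩, rfl⟩
      simp [Φ]
  have hcomp : zeroComponent f = funGraph f := by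
    refine IsPreconnected.connectedComponentIn ?_ (zero_mem_funGraph hf)
    rw [himage]
    exact ((isPreconnected_range_graph_of_meets_isClosed hmeet).prod isPreconnected_univ).image _
      hΦ.continuousOn
  have hsurj : Function.Surjective Φ := fun p => ⟨((p.1 i, p.2), p.1), by simp [Φ]⟩
  have hdense : Dense (zeroComponent f) := by
    rw [hcomp, himage]
    exact hsurj.denseRange.dense_image hΦ
      ((dense_range_graph_of_meets_isClosed hmeet).prod dense_univ)
  exact ⟨⊤, by simp, zeroComponentSubgroup hf, rfl, fun _ _ => trivial,
    fun p _ => hdense p⟩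

/-- A `ℚ`-linear map that vanishes on a nondegenerate interval starting at zero vanishes. -/
theorem LinearMap.eq_zero_of_uIcc {M : Type*} [AddCommGroup M] [Module ℚ M] (g : ℝ →ₗ[ℚ] M) {t : ℝ}
    (ht : t ≠ 0) (h : ∀ x ∈ uIcc 0 t, g x = 0) : g = 0 := by
  ext1
  have hx : ∀ x, g x = 0 := fun x => by
    have hx : x = ⌊x / t⌋ • t + Int.fract (x / t) * t := by
      rw [zsmul_eq_mul, ← add_mul, Int.floor_add_fract, div_mul_cancel₀ _ ht]
    have h0 := Int.fract_nonneg (x / t)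
    have h1 := (Int.fract_lt_one (x / t)).le
    rw [hx, map_add, map_zsmul, h t right_mem_uIcc, h _ ?_, smul_zero, add_zero]
    rw [mem_uIcc]
    rcases le_total 0 t with h2 | h2
    · exact Or.inl ⟨mul_nonneg h0 h2, mul_le_of_le_one_left h2 h1⟩
    · exact Or.inr ⟨by nlinarith, mul_nonpos_of_nonneg_of_nonpos h0 h2⟩
  exact hx _

/-- For `s ≤ d` there is an additive function on `ℝ^d` such that the component of the origin in its
graph is an `s`-dimensional coordinate subspace. -/
theorem exists_zeroComponent_eq_submodule {d s : ℕ} (hs : s ≤ d) :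
    ∃ f : (Fin d → ℝ) → ℝ, IsAdditiveFun f ∧
      (∃ A : Fin d → ℝ → ℝ, (∀ k, IsAdditiveFun (A k)) ∧ ∀ x, f x = ∑ k, A k (x k)) ∧
      IsDenseSubgroupOfDim (zeroComponent f) s := by
  obtain ⟨g, hg0⟩ := exists_rat_linearMap_ne_zero
  obtain ⟨c, hc, -⟩ := exists_linearIndependent_rat_selector (ι := Fin d)
    ((Cardinal.mk_lt_aleph0.trans Cardinal.aleph0_lt_continuum).le) (fun _ => univ)
    fun _ => by rw [Cardinal.mk_univ_real]
  let q : (Fin d → ℝ) → Fin d → ℚ := fun x k => if (k : ℕ) < s then 0 else g (x k)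
  -- Rational independence of the `c k` lets the single value `f x` recover every `g (x k)` with `s
  -- ≤ k`.
  let A : Fin d → ℝ → ℝ := fun k t => if (k : ℕ) < s then 0 else g t • c k
  have hA : ∀ k, IsAdditiveFun (A k) := fun k x y => by
    by_cases hk : (k : ℕ) < s
    · simp [A, hk]
    · simp [A, hk, add_smul]
  have hf := IsAdditiveFun.sum_coord hA
  refine ⟨_, hf, ⟨A, hA, fun _ => rfl⟩, ?_⟩
  set f : (Fin d → ℝ) → ℝ := fun x => ∑ k, A k (x k)
  have hfq : ∀ x, f x = ∑ k, q x k • c k := fun x =>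
    Finset.sum_congr rfl fun k _ => by by_cases hk : (k : ℕ) < s <;> simp [A, q, hk]
  let L : (Fin s → ℝ) →ₗ[ℝ] (Fin d → ℝ) × ℝ :=
    LinearMap.inl ℝ _ _ ∘ₗ Function.ExtendByZero.linearMap ℝ (Fin.castLE hs)
  have hLinj : Function.Injective L := by
    intro v w hvw
    have h1 : Function.extend (Fin.castLE hs) v 0 = Function.extend (Fin.castLE hs) w 0 :=
      congrArg Prod.fst hvw
    exact Function.extend_injective (Fin.castLE_injective hs) 0 h1
  have hmem : ∀ p : (Fin d → ℝ) × ℝ,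
      p ∈ LinearMap.range L ↔ (∀ k : Fin d, s ≤ k → p.1 k = 0) ∧ p.2 = 0 := by
    intro p
    constructor
    · rintro ⟨v, rfl⟩
      refine ⟨fun k hk => ?_, rfl⟩
      refine Function.extend_apply' v (0 : Fin d → ℝ) k ?_
      rintro ⟨j, rfl⟩
      exact absurd j.2 (not_lt.2 hk)
    · rintro ⟨h1, h2⟩
      refine ⟨fun j => p.1 (Fin.castLE hs j), Prod.ext (funext fun k => ?_) h2.symm⟩
      change Function.extend (Fin.castLE hs) (fun j => p.1 (Fin.castLE hs j)) (0 : Fin d → ℝ) k = _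
      by_cases hk : (k : ℕ) < s
      · exact (Fin.castLE_injective hs).extend_apply (fun j => p.1 (Fin.castLE hs j)) 0 ⟨k, hk⟩
      · rw [h1 k (not_lt.1 hk), Function.extend_apply']
        · rfl
        · rintro ⟨j, rfl⟩
          exact hk j.2
  have hcomp : zeroComponent f = LinearMap.range L := by
    have hpre : IsPreconnected (zeroComponent f) := isPreconnected_connectedComponentIn
    have hsub : zeroComponent f ⊆ funGraph f := connectedComponentIn_subset _ _
    have hzero : (0 : (Fin d → ℝ) × ℝ) ∈ zeroComponent f :=
      mem_connectedComponentIn (zero_mem_funGraph hf)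
    refine Subset.antisymm (fun p hp => (hmem p).2 ?_) ?_
    · have hsnd : ∀ p ∈ zeroComponent f, p.2 = 0 := by
        -- Connected subsets of a countable set of reals are singletons, so the last coordinate is
        -- constant on the component.
        have hcount : (range fun r : Fin d → ℚ => ∑ k, r k • c k).Countable := countable_range _
        have := hcount.isTotallyDisconnected (Prod.snd '' zeroComponent f)
          (by
            rintro _ ⟨p, hp, rfl⟩
            exact ⟨q p.1, (hfq p.1).symm.trans (mem_funGraph.1 (hsub hp))⟩)
          (hpre.image _ continuous_snd.continuousOn)
        exact fun p hp => this (mem_image_of_mem _ hp) (mem_image_of_mem _ hzero)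
      have hker : ∀ p ∈ zeroComponent f, ∀ k : Fin d, s ≤ k → g (p.1 k) = 0 := by
        intro p hp k hk
        have h1 : ∑ k, q p.1 k • c k = 0 := by
          rw [← hfq, mem_funGraph.1 (hsub hp), hsnd p hp]
        have h2 := Fintype.linearIndependent_iff.1 hc _ h1 k
        simpa [q, not_lt.2 hk] using h2
      refine ⟨fun k hk => ?_, hsnd p hp⟩
      by_contra hne
      -- A nonzero `k`-th coordinate would put a whole interval in the kernel of `g`.
      refine hg0 (g.eq_zero_of_uIcc hne fun x hx => ?_)
      have hproj : IsPreconnected ((fun p : (Fin d → ℝ) × ℝ => p.1 k) '' zeroComponent f) :=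
        hpre.image _ (by fun_prop)
      obtain ⟨r, hr, rfl⟩ := hproj.ordConnected.uIcc_subset ⟨0, hzero, rfl⟩ ⟨p, hp, rfl⟩ hx
      exact hker r hr k hk
    · refine (LinearMap.range L).convex.isPreconnected.subset_connectedComponentIn
        (zero_mem _) fun p hp => mem_funGraph.2 ?_
      obtain ⟨h1, h2⟩ := (hmem p).1 hp
      rw [h2, hfq]
      refine Finset.sum_eq_zero fun k _ => ?_
      by_cases hk : (k : ℕ) < s
      · simp [q, hk]
      · simp [q, hk, h1 k (not_lt.1 hk)]
  refine ⟨LinearMap.range L, ?_, (LinearMap.range L).toAddSubgroup, hcomp.symm, hcomp.le, ?_⟩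
  · rw [LinearMap.finrank_range_of_inj hLinj, Module.finrank_fin_fun]
  · rw [hcomp]
    exact subset_closure

theorem theorem3 (d : ℕ) (hd : 1 ≤ d) :
    (∀ f : (Fin d → ℝ) → ℝ, IsAdditiveFun f →
      (∃ s : ℕ, s ≤ d + 1 ∧ IsDenseSubgroupOfDim (zeroComponent f) s) ∧
      (∀ C : Set ((Fin d → ℝ) × ℝ), IsGraphComponent f C →
        ∃ τ : (Fin d → ℝ) × ℝ, C = (fun p => τ + p) '' zeroComponent f)) ∧
    (∀ s : ℕ, s ≤ d + 1 →
      ∃ f : (Fin d → ℝ) → ℝ, IsAdditiveFun f ∧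
        (∃ A : Fin d → ℝ → ℝ, (∀ k, IsAdditiveFun (A k)) ∧ ∀ x, f x = ∑ k, A k (x k)) ∧
        IsDenseSubgroupOfDim (zeroComponent f) s) := by
  refine ⟨fun f hf => ⟨exists_isDenseSubgroupOfDim_zeroComponent hf, ?_⟩, fun s hs => ?_⟩
  · rintro _ ⟨p, hp, rfl⟩
    exact ⟨p, connectedComponentIn_funGraph hf hp⟩
  · rcases hs.lt_or_eq with h | rfl
    · exact exists_zeroComponent_eq_submodule (Nat.lt_succ_iff.1 h)
    · exact exists_zeroComponent_dense hd
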